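/- Let $n\ge 0$ and let $\mathcal X$ be a random subset of $\{1,\dots,n\}$ (a measurable map from a probability space to the subsets of $\{1,\dots,n\}$). For a matrix $A$ write $A_X$ for its submatrix with rows and columns in $X$, and $A_{X,:}$ for its submatrix with rows in $X$; the empty determinant is $1$. For a symmetric $K\in\mathbb R^{n\times n}$ with $0\preceq K\preceq I$, $\mathcal X$ is a \emph{DPP with marginal kernel $K$} if $\mathbb P(A\subseteq\mathcal X)=\det K_A$ for all $A\subseteq\{1,\dots,n\}$. A \emph{nonnegative pair} $(L;V)$ consists of a symmetric $L\in\mathbb R^{n\times n}$ and a matrix $V\in\mathbb R^{n\times p}$, $0\le p\le n$, of full column rank $p$, such that $x^\top Lx\ge 0$ for every $x\in\mathbb R^n$ with $V^\top x=0$. $\mathcal X$ is an \emph{extended L-ensemble based on $(L;V)$} if $(L;V)$ is a nonnegative pair and there is a constant $c>0$ such that for all $X\subseteq\{1,\dots,n\}$ $$\mathbb P(\mathcal X=X)=c\,(-1)^p\det\begin{pmatrix}L_X&V_{X,:}\\(V_{X,:})^\top&0\end{pmatrix}.$$ \textbf{Theorem.} (1) Let $\mathcal X$ be a DPP with marginal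 kernel $K$, $0\preceq K\preceq I$. Then there is a matrix $V\in\mathbb R^{n\times p}$, $p\ge0$, whose columns form an orthonormal basis of the eigenspace of $K$ for the eigenvalue $1$ ($p=0$ if $1$ is not an eigenvalue); and for every such $V$, with $L=K(I-K)^\dagger$ where $\dagger$ is the Moore--Penrose pseudo-inverse, $(L;V)$ is a nonnegative pair and $\mathcal X$ is an extended L-ensemble based on $(L;V)$. (2) Consequently, together with the converse, DPPs and extended L-ensembles are the same class: $\mathcal X$ is a DPP with some marginal kernel $0\preceq K\preceq I$ if and only if $\mathcal X$ is an extended L-ensemble based on some nonnegative pair $(L;V)$. -/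

import Mathlib

open MeasureTheory

/-! ### The Moore–Penrose pseudo-inverse -/

/-- `B` is a Moore–Penrose pseudo-inverse of the real matrix `A`: the four Penrose equations. -/
structure IsPseudoInverse {m n : ℕ} (A : Matrix (Fin m) (Fin n) ℝ)
    (B : Matrix (Fin n) (Fin m) ℝ) : Prop where
  mul_mul_left : A * B * A = A
  mul_mul_right : B * A * B = B
  isSymm_left : (A * B).IsSymm
  isSymm_right : (B * A).IsSymm

theorem IsPseudoInverse.unique {m n : ℕ} {A : Matrix (Fin m) (Fin n) ℝ}
    {B C : Matrix (Fin n) (Fin m) ℝ} (hB : IsPseudoInverse A B) (hC : IsPseudoInverse A C) :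
    B = C := by
  have h1 : A * B = A * C := by
    have e : (A * C * (A * B)).transpose = A * B * (A * C) := by
      rw [Matrix.transpose_mul, hB.isSymm_left.eq, hC.isSymm_left.eq]
    have e1 : A * C * (A * B) = A * B := by rw [← Matrix.mul_assoc, hC.mul_mul_left]
    have e2 : A * B * (A * C) = A * C := by rw [← Matrix.mul_assoc, hB.mul_mul_left]
    rw [e1, e2, hB.isSymm_left.eq] at e
    exact e
  have h2 : B * A = C * A := by
    have e : (B * A * (C * A)).transpose = C * A * (B * A) := by
      rw [Matrix.transpose_mul, hB.isSymm_right.eq, hC.isSymm_right.eq]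
    have e1 : B * A * (C * A) = B * A := by
      rw [Matrix.mul_assoc, ← Matrix.mul_assoc A, hC.mul_mul_left]
    have e2 : C * A * (B * A) = C * A := by
      rw [Matrix.mul_assoc, ← Matrix.mul_assoc A, hB.mul_mul_left]
    rw [e1, e2, hB.isSymm_right.eq] at e
    exact e
  rw [← hB.mul_mul_right, h2, Matrix.mul_assoc, h1, ← Matrix.mul_assoc, hC.mul_mul_right]

theorem exists_isPseudoInverse_of_isHermitian {n : ℕ} {A : Matrix (Fin n) (Fin n) ℝ}
    (hA : A.IsHermitian) : ∃ B, IsPseudoInverse A B ∧ B.IsSymm := by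
  obtain ⟨U, d, hU, rfl⟩ : ∃ (U : Matrix (Fin n) (Fin n) ℝ) (d : Fin n → ℝ),
      U.transpose * U = 1 ∧ A = U * Matrix.diagonal d * U.transpose := by
    refine ⟨hA.eigenvectorUnitary, hA.eigenvalues, ?_, ?_⟩
    · have := Unitary.coe_star_mul_self hA.eigenvectorUnitary
      rwa [Matrix.star_eq_conjTranspose, Matrix.conjTranspose_eq_transpose_of_trivial] at this
    · have := hA.spectral_theorem
      rw [Unitary.conjStarAlgAut_apply, Matrix.star_eq_conjTranspose,
        Matrix.conjTranspose_eq_transpose_of_trivial] at this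
      exact this
  have key : ∀ a b : Fin n → ℝ,
      U * Matrix.diagonal a * U.transpose * (U * Matrix.diagonal b * U.transpose) =
        U * Matrix.diagonal (fun i => a i * b i) * U.transpose := by
    intro a b
    calc _ = U * Matrix.diagonal a * (U.transpose * U) * Matrix.diagonal b * U.transpose := by
          simp only [Matrix.mul_assoc]
      _ = _ := by
          rw [hU, Matrix.mul_one, Matrix.mul_assoc U, Matrix.diagonal_mul_diagonal]
  have symm : ∀ a : Fin n → ℝ, (U * Matrix.diagonal a * U.transpose).IsSymm := by
    intro a
    simp [Matrix.IsSymm, Matrix.transpose_mul, Matrix.mul_assoc]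
  refine ⟨U * Matrix.diagonal (fun i => (d i)⁻¹) * U.transpose, ⟨?_, ?_, ?_, ?_⟩, symm _⟩
  · rw [key, key]
    congr 3
    funext i
    exact mul_inv_mul_cancel (d i)
  · rw [key, key]
    congr 3
    funext i
    simpa using mul_inv_mul_cancel (d i)⁻¹
  · rw [key]; exact symm _
  · rw [key]; exact symm _

theorem exists_isPseudoInverse {m n : ℕ} (A : Matrix (Fin m) (Fin n) ℝ) :
    ∃ B, IsPseudoInverse A B := by
  obtain ⟨G, hG, hGs⟩ := exists_isPseudoInverse_of_isHermitian
    (Matrix.isHermitian_conjTranspose_mul_self A)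
  rw [Matrix.conjTranspose_eq_transpose_of_trivial] at hG
  have h0 : A * (G * (A.transpose * A)) = A := by
    have h := hG.mul_mul_left
    have h' : A.conjTranspose * A * (G * (A.transpose * A) - 1) = 0 := by
      rw [Matrix.conjTranspose_eq_transpose_of_trivial, Matrix.mul_sub, Matrix.mul_one,
        ← Matrix.mul_assoc, h, sub_self]
    rw [Matrix.conjTranspose_mul_self_mul_eq_zero, Matrix.mul_sub, Matrix.mul_one,
      sub_eq_zero] at h'
    exact h'
  refine ⟨G * A.transpose, ?_, ?_, ?_, ?_⟩
  · simpa only [Matrix.mul_assoc] using h0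
  · have h := congrArg (· * A.transpose) hG.mul_mul_right
    simpa only [Matrix.mul_assoc] using h
  · simp [Matrix.IsSymm, Matrix.transpose_mul, hGs.eq, Matrix.mul_assoc]
  · have h := hG.isSymm_right
    rwa [← Matrix.mul_assoc] at h

/-- The Moore–Penrose pseudo-inverse of a real matrix. -/
noncomputable def pseudoInverse {m n : ℕ} (A : Matrix (Fin m) (Fin n) ℝ) :
    Matrix (Fin n) (Fin m) ℝ :=
  (exists_isPseudoInverse A).choose

theorem isPseudoInverse_pseudoInverse {m n : ℕ} (A : Matrix (Fin m) (Fin n) ℝ) :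
    IsPseudoInverse A (pseudoInverse A) :=
  (exists_isPseudoInverse A).choose_spec

/-! ### Determinantal point processes and extended L-ensembles on `Fin n` -/

/-- `0 ⪯ K ⪯ I` in the Loewner order (positive semidefinite matrices are symmetric). -/
structure IsMarginalKernel {n : ℕ} (K : Matrix (Fin n) (Fin n) ℝ) : Prop where
  posSemidef : K.PosSemidef
  posSemidef_one_sub : (1 - K).PosSemidef

/-- The random subset `𝒳` of `Fin n` is a determinantal point process with marginal kernel `K`:
`0 ⪯ K ⪯ I` and `P(A ⊆ 𝒳) = det K_A` for every `A`. (The empty determinant is `1`.) -/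
structure IsDPP {n : ℕ} {Ω : Type*} [MeasurableSpace Ω] (P : Measure Ω)
    (𝒳 : Ω → Finset (Fin n)) (K : Matrix (Fin n) (Fin n) ℝ) : Prop where
  isMarginalKernel : IsMarginalKernel K
  inclusion : ∀ A : Finset (Fin n),
    P.real {ω | A ⊆ 𝒳 ω} = (K.submatrix (fun i : A => (i : Fin n)) (fun i : A => (i : Fin n))).det

/-- `(L, V)` is a nonnegative pair: `L` is symmetric, `V` has full column rank `p`
(so `p ≤ n`), and `xᵀ L x ≥ 0` for every `x` with `Vᵀ x = 0`. -/
structure IsNonnegativePair {n p : ℕ} (L : Matrix (Fin n) (Fin n) ℝ)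
    (V : Matrix (Fin n) (Fin p) ℝ) : Prop where
  isSymm : L.IsSymm
  rank_eq : V.rank = p
  nonneg : ∀ x : Fin n → ℝ, V.transpose.mulVec x = 0 → 0 ≤ x ⬝ᵥ L.mulVec x

/-- The saddle-point matrix with blocks `L_X`, `V_{X,:}`, `(V_{X,:})ᵀ`, `0`. -/
def saddleMatrix {n p : ℕ} (L : Matrix (Fin n) (Fin n) ℝ) (V : Matrix (Fin n) (Fin p) ℝ)
    (X : Finset (Fin n)) : Matrix (X ⊕ Fin p) (X ⊕ Fin p) ℝ :=
  Matrix.fromBlocks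
    (L.submatrix (fun i : X => (i : Fin n)) (fun i : X => (i : Fin n)))
    (V.submatrix (fun i : X => (i : Fin n)) id)
    (V.submatrix (fun i : X => (i : Fin n)) id).transpose
    0

/-- `𝒳` is an extended L-ensemble based on `(L, V)`: `(L, V)` is a nonnegative pair and
`P(𝒳 = X)` is proportional to `(-1)^p` times the determinant of the saddle-point matrix, with a
positive constant of proportionality that does not depend on `X`. -/
structure IsExtendedLEnsemble {n p : ℕ} {Ω : Type*} [MeasurableSpace Ω] (P : Measure Ω)
    (𝒳 : Ω → Finset (Fin n)) (L : Matrix (Fin n) (Fin n) ℝ) (V : Matrix (Fin n) (Fin p) ℝ) :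
    Prop where
  isNonnegativePair : IsNonnegativePair L V
  proportional : ∃ c : ℝ, 0 < c ∧ ∀ X : Finset (Fin n),
    P.real {ω | 𝒳 ω = X} = c * ((-1) ^ p * (saddleMatrix L V X).det)

/-- The columns of `V` form an orthonormal basis of the eigenspace of `K` for the eigenvalue `1`
(which is `0` when `1` is not an eigenvalue; then `p = 0`). -/
structure IsOneEigenbasis {n p : ℕ} (K : Matrix (Fin n) (Fin n) ℝ)
    (V : Matrix (Fin n) (Fin p) ℝ) : Prop where
  orthonormal : V.transpose * V = 1
  span_eq : Submodule.span ℝ (Set.range V.col) = Module.End.eigenspace (Matrix.toLin' K) 1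

/-! Both classes are read off the generating function G(t) = E ∏_{i ∈ 𝒳} t_i, which is multi-affine
and so determines its coefficients. With T = diag(t), a DPP means G(t) = det(I - K + TK), and the
saddle-point formula means G(t) = c(-1)^p det B(t), where B(t) has blocks I + TL, TV, Vᵀ, 0. What
remains is matrix algebra.

From K to (L;V): B(t) times the matrix S with blocks I - K, V, Vᵀ, 0 is block triangular with
diagonal blocks I - K + TK and I, and det S = (-1)^p det(I - K + VVᵀ). That last determinant is
positive and serves as c.

Conversely, G(1) = 1 makes B(1) invertible. If C is the top-left block of its inverse, B(t)B(1)⁻¹ is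
block triangular with corner C + T(I - C), so K = I - C. From VᵀC = 0 follows C = C² + CLC with CLC
⪰ 0, hence 0 ⪯ C ⪯ I. -/

/-! ### Bordered determinants as multi-affine polynomials -/

/-- A bordered determinant whose rows outside `X` are unit vectors is the bordered minor of `X`. -/
theorem det_piecewise_one_row {n : ℕ} {κ : Type*} [Fintype κ] [DecidableEq κ]
    (A : Matrix (Fin n) (Fin n) ℝ) (B : Matrix (Fin n) κ ℝ) (C : Matrix κ (Fin n) ℝ)
    (D : Matrix κ κ ℝ) (X : Finset (Fin n)) :
    (Matrix.fromBlocks (Matrix.of fun i j => if i ∈ X then A i j else (1 : Matrix _ _ ℝ) i j)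
      (Matrix.of fun i j => if i ∈ X then B i j else 0) C D).det =
      (Matrix.fromBlocks (A.submatrix (fun i : X => (i : Fin n)) (fun i : X => (i : Fin n)))
        (B.submatrix (fun i : X => (i : Fin n)) id)
        (C.submatrix id (fun i : X => (i : Fin n))) D).det := by
  classical
  -- Moving the indices outside `X` to the end makes the matrix block upper triangular with an
  -- identity corner.
  let e : (X ⊕ κ) ⊕ {i // i ∉ X} ≃ Fin n ⊕ κ :=
    (Equiv.sumAssoc _ _ _).trans (((Equiv.refl _).sumCongr (Equiv.sumComm _ _)).trans
      ((Equiv.sumAssoc _ _ _).symm.trans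
        ((Equiv.sumCompl (fun i => i ∈ X)).sumCongr (Equiv.refl κ))))
  rw [← Matrix.det_submatrix_equiv_self e, ← Matrix.fromBlocks_toBlocks
    ((Matrix.fromBlocks
      (Matrix.of fun i j => if i ∈ X then A i j else (1 : Matrix _ _ ℝ) i j)
      (Matrix.of fun i j => if i ∈ X then B i j else 0) C D).submatrix e e)]
  have h21 : ((Matrix.fromBlocks
      (Matrix.of fun i j => if i ∈ X then A i j else (1 : Matrix _ _ ℝ) i j)
      (Matrix.of fun i j => if i ∈ X then B i j else 0) C D).submatrix
      e e).toBlocks₂₁ = 0 := by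
    ext ⟨i, hi⟩ (⟨j, hj⟩ | j)
    · have hij : i ≠ j := fun h => hi (h ▸ hj)
      simp [Matrix.toBlocks₂₁, e, hi, Matrix.one_apply_ne hij]
    · simp [Matrix.toBlocks₂₁, e, hi]
  have h22 : ((Matrix.fromBlocks
      (Matrix.of fun i j => if i ∈ X then A i j else (1 : Matrix _ _ ℝ) i j)
      (Matrix.of fun i j => if i ∈ X then B i j else 0) C D).submatrix
      e e).toBlocks₂₂ = 1 := by
    ext ⟨i, hi⟩ ⟨j, hj⟩
    simp [Matrix.toBlocks₂₂, e, hi, Matrix.one_apply]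
  rw [h21, h22, Matrix.det_fromBlocks_zero₂₁, Matrix.det_one, mul_one]
  congr 1
  ext (i | i) (j | j) <;> simp [Matrix.toBlocks₁₁, e]

/-- Expansion of a bordered determinant into bordered principal minors. -/
theorem det_fromBlocks_one_add_diagonal_mul {n : ℕ} {κ : Type*} [Fintype κ] [DecidableEq κ]
    (A : Matrix (Fin n) (Fin n) ℝ) (B : Matrix (Fin n) κ ℝ) (C : Matrix κ (Fin n) ℝ)
    (D : Matrix κ κ ℝ) (t : Fin n → ℝ) :
    (Matrix.fromBlocks (1 + Matrix.diagonal t * A) (Matrix.diagonal t * B) C D).det =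
      ∑ X : Finset (Fin n), (∏ i ∈ X, t i) *
        (Matrix.fromBlocks (A.submatrix (fun i : X => (i : Fin n)) (fun i : X => (i : Fin n)))
          (B.submatrix (fun i : X => (i : Fin n)) id)
          (C.submatrix id (fun i : X => (i : Fin n))) D).det := by
  classical
  -- The border rows are held fixed; the determinant is expanded multilinearly in the first `n`
  -- rows, each the sum of a unit row and a scaled row.
  let f := (Matrix.detRowAlternating (R := ℝ) (n := Fin n ⊕ κ)).toMultilinearMap.currySum
  let r : Fin n → (Fin n ⊕ κ → ℝ) := fun i => Sum.elim (A i) (B i)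
  let r₁ : Fin n → (Fin n ⊕ κ → ℝ) := fun i => Sum.elim ((1 : Matrix (Fin n) (Fin n) ℝ) i) 0
  let w : κ → (Fin n ⊕ κ → ℝ) := fun k => Sum.elim (C k) (D k)
  have h0 : (Matrix.fromBlocks (1 + Matrix.diagonal t * A) (Matrix.diagonal t * B) C D).det =
      f ((fun i => t i • r i) + r₁) w := by
    change Matrix.det _ = Matrix.det _
    congr 1
    ext (i | i) (j | j) <;> simp [r, r₁, w, add_comm]
  rw [h0, MultilinearMap.map_add_univ, sum_apply]
  refine Finset.sum_congr rfl fun X _ => ?_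
  have h1 : X.piecewise (fun i => t i • r i) r₁ =
      X.piecewise (fun i => t i • X.piecewise r r₁ i) (X.piecewise r r₁) := by
    ext i j
    by_cases hi : i ∈ X <;> simp [hi]
  rw [h1, MultilinearMap.map_piecewise_smul, smul_apply, smul_eq_mul,
    ← det_piecewise_one_row]
  congr 1
  change Matrix.det _ = Matrix.det _
  congr 1
  ext (i | i) (j | j)
  · by_cases hi : i ∈ X <;> simp [r, r₁, hi]
  · by_cases hi : i ∈ X <;> simp [r, r₁, hi]
  · simp [w]
  · simp [w]

theorem det_one_add_diagonal_mul {n : ℕ} (K : Matrix (Fin n) (Fin n) ℝ) (t : Fin n → ℝ) :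
    (1 + Matrix.diagonal t * K).det = ∑ A : Finset (Fin n), (∏ i ∈ A, t i) *
      (K.submatrix (fun i : A => (i : Fin n)) (fun i : A => (i : Fin n))).det := by
  have h := det_fromBlocks_one_add_diagonal_mul K (0 : Matrix (Fin n) (Fin 0) ℝ) 0 0 t
  simpa using h

theorem det_saddle_generating {n p : ℕ} (L : Matrix (Fin n) (Fin n) ℝ)
    (V : Matrix (Fin n) (Fin p) ℝ) (t : Fin n → ℝ) :
    (Matrix.fromBlocks (1 + Matrix.diagonal t * L) (Matrix.diagonal t * V) V.transpose 0).det =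
      ∑ X : Finset (Fin n), (∏ i ∈ X, t i) * (saddleMatrix L V X).det :=
  det_fromBlocks_one_add_diagonal_mul L V V.transpose 0 t

/-- A multi-affine function determines its coefficients. -/
theorem multiaffine_coeff_unique {n : ℕ} {a b : Finset (Fin n) → ℝ}
    (h : ∀ t : Fin n → ℝ, ∑ X, (∏ i ∈ X, t i) * a X = ∑ X, (∏ i ∈ X, t i) * b X) : a = b := by
  classical
  funext Y
  induction Y using Finset.strongInduction with
  | H Y ih =>
    have key : ∀ c : Finset (Fin n) → ℝ,
        ∑ X, (∏ i ∈ X, if i ∈ Y then (1 : ℝ) else 0) * c X = ∑ X ∈ Y.powerset, c X := by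
      intro c
      rw [← Finset.sum_subset (Finset.subset_univ Y.powerset)]
      · refine Finset.sum_congr rfl fun X hX => ?_
        rw [Finset.prod_eq_one, one_mul]
        exact fun i hi => if_pos (Finset.mem_powerset.1 hX hi)
      · intro X _ hX
        obtain ⟨i, hi, hiY⟩ := Finset.not_subset.1 (fun h => hX (Finset.mem_powerset.2 h))
        rw [Finset.prod_eq_zero hi (if_neg hiY), zero_mul]
    -- At the indicator of `Y` only the subsets of `Y` survive, and the proper ones agree by
    -- induction.
    have hY := h (fun i => if i ∈ Y then 1 else 0)
    rw [key, key, ← Finset.insert_erase (Finset.mem_powerset_self Y),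
      Finset.sum_insert (Finset.notMem_erase _ _),
      Finset.sum_insert (Finset.notMem_erase _ _)] at hY
    have hs : ∑ X ∈ Y.powerset.erase Y, a X = ∑ X ∈ Y.powerset.erase Y, b X := by
      refine Finset.sum_congr rfl fun X hX => ih X ?_
      obtain ⟨h1, h2⟩ := Finset.mem_erase.1 hX
      exact (Finset.mem_powerset.1 h2).ssubset_of_ne h1
    linarith

/-! ### Generating functions of a random subset -/

section Probability

variable {n : ℕ} {Ω : Type*} [MeasurableSpace Ω] {P : Measure Ω} [IsProbabilityMeasure P]
  {𝒳 : Ω → Finset (Fin n)}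

theorem measureReal_mem_eq_sum (h𝒳 : Measurable 𝒳) (S : Finset (Finset (Fin n))) :
    P.real {ω | 𝒳 ω ∈ S} = ∑ X ∈ S, P.real {ω | 𝒳 ω = X} := by
  rw [← measureReal_biUnion_finset]
  · congr 1
    ext ω
    simp
  · intro X _ Y _ hXY
    exact Set.disjoint_left.2 fun ω h1 h2 => hXY (h1.symm.trans h2)
  · exact fun X _ => h𝒳 (measurableSet_singleton X)

theorem sum_measureReal_eq_one (h𝒳 : Measurable 𝒳) :
    ∑ X, P.real {ω | 𝒳 ω = X} = 1 := by
  rw [← measureReal_mem_eq_sum h𝒳]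
  simp

/-- Expanding each product over subsets and exchanging the sums: the shift t = 1 + s turns point
probabilities into inclusion probabilities. -/
theorem sum_prod_one_add_mul_measureReal (h𝒳 : Measurable 𝒳) (s : Fin n → ℝ) :
    ∑ X, (∏ i ∈ X, (1 + s i)) * P.real {ω | 𝒳 ω = X} =
      ∑ A, (∏ i ∈ A, s i) * P.real {ω | A ⊆ 𝒳 ω} := by
  classical
  have h : ∀ A : Finset (Fin n), P.real {ω | A ⊆ 𝒳 ω} =
      ∑ X, if A ⊆ X then P.real {ω | 𝒳 ω = X} else 0 := by
    intro A
    rw [← Finset.sum_filter, ← measureReal_mem_eq_sum h𝒳]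
    simp
  simp_rw [h, Finset.prod_one_add, Finset.sum_mul, Finset.mul_sum]
  rw [Finset.sum_comm]
  refine Finset.sum_congr rfl fun X _ => ?_
  simp_rw [mul_ite, mul_zero]
  rw [← Finset.sum_filter]
  refine Finset.sum_congr ?_ fun _ _ => rfl
  ext A
  simp

/-- The inclusion probabilities are the principal minors of `K` exactly when the probability
generating function of `𝒳` is `t ↦ det (1 - K + diag(t) K)`. -/
theorem inclusion_iff_generating (h𝒳 : Measurable 𝒳) (K : Matrix (Fin n) (Fin n) ℝ) :
    (∀ A : Finset (Fin n), P.real {ω | A ⊆ 𝒳 ω} =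
      (K.submatrix (fun i : A => (i : Fin n)) (fun i : A => (i : Fin n))).det) ↔
    ∀ t : Fin n → ℝ, ∑ X, (∏ i ∈ X, t i) * P.real {ω | 𝒳 ω = X} =
      (1 - K + Matrix.diagonal t * K).det := by
  have hdiag : ∀ s : Fin n → ℝ, 1 - K + Matrix.diagonal (fun i => 1 + s i) * K =
      1 + Matrix.diagonal s * K := by
    intro s
    rw [← Matrix.diagonal_add, Matrix.diagonal_one, add_mul, one_mul]
    abel
  constructor
  · intro h t
    have ht : t = fun i => 1 + (t i - 1) := by funext i; ring
    rw [ht, hdiag, sum_prod_one_add_mul_measureReal h𝒳, det_one_add_diagonal_mul]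
    simp_rw [h]
  · intro h
    refine congrFun (multiaffine_coeff_unique fun s => ?_)
    rw [← sum_prod_one_add_mul_measureReal h𝒳, h, hdiag, det_one_add_diagonal_mul]

end Probability

/-- The saddle-point formula for the point probabilities in terms of the probability generating
function of `𝒳`. -/
theorem proportional_iff_generating {n p : ℕ} {Ω : Type*} [MeasurableSpace Ω] {P : Measure Ω}
    {𝒳 : Ω → Finset (Fin n)} (L : Matrix (Fin n) (Fin n) ℝ)
    (V : Matrix (Fin n) (Fin p) ℝ) (c : ℝ) :
    (∀ X : Finset (Fin n), P.real {ω | 𝒳 ω = X} = c * ((-1) ^ p * (saddleMatrix L V X).det)) ↔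
    ∀ t : Fin n → ℝ, ∑ X, (∏ i ∈ X, t i) * P.real {ω | 𝒳 ω = X} =
      c * ((-1) ^ p * (Matrix.fromBlocks (1 + Matrix.diagonal t * L) (Matrix.diagonal t * V)
        V.transpose 0).det) := by
  have hsum : ∀ t : Fin n → ℝ, ∑ X, (∏ i ∈ X, t i) * (c * ((-1) ^ p * (saddleMatrix L V X).det)) =
      c * ((-1) ^ p * (Matrix.fromBlocks (1 + Matrix.diagonal t * L) (Matrix.diagonal t * V)
        V.transpose 0).det) := by
    intro t
    rw [det_saddle_generating, Finset.mul_sum, Finset.mul_sum]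
    exact Finset.sum_congr rfl fun X _ => by ring
  constructor
  · intro h t
    simp_rw [h, hsum]
  · intro h
    refine congrFun (multiaffine_coeff_unique fun t => ?_)
    rw [h, hsum]

/-! ### The eigenspace for 1 and its orthogonal projection -/

theorem exists_isOneEigenbasis {n : ℕ} (K : Matrix (Fin n) (Fin n) ℝ) :
    ∃ (p : ℕ) (V : Matrix (Fin n) (Fin p) ℝ), IsOneEigenbasis K V := by
  -- The eigenspace is transported to the Euclidean space, which carries the inner product.
  let S : Submodule ℝ (EuclideanSpace ℝ (Fin n)) :=
    (Module.End.eigenspace (Matrix.toLin' K) 1).comap (WithLp.linearEquiv 2 ℝ (Fin n → ℝ)).toLinearMap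
  let b := stdOrthonormalBasis ℝ S
  refine ⟨Module.finrank ℝ S, Matrix.of fun i j => (b j : EuclideanSpace ℝ (Fin n)) i, ?_, ?_⟩
  · ext i j
    have h := (orthonormal_iff_ite.1 b.orthonormal) j i
    rw [Submodule.coe_inner, EuclideanSpace.inner_eq_star_dotProduct] at h
    rw [Matrix.mul_apply, Matrix.one_apply]
    simp only [Matrix.transpose_apply, Matrix.of_apply]
    rw [if_congr (eq_comm (a := i)) rfl rfl, ← h]
    rfl
  · have h1 : Submodule.span ℝ (Set.range fun j => (b j : EuclideanSpace ℝ (Fin n))) = S := by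
      have h := congrArg (Submodule.map S.subtype) b.toBasis.span_eq
      rw [Submodule.map_span, Submodule.map_top, Submodule.range_subtype, ← Set.range_comp] at h
      simpa [Function.comp_def] using h
    have h2 := congrArg (Submodule.map (WithLp.linearEquiv 2 ℝ (Fin n → ℝ)).toLinearMap) h1
    rw [Submodule.map_span, ← Set.range_comp,
      Submodule.map_comap_eq_of_surjective (WithLp.linearEquiv 2 ℝ (Fin n → ℝ)).surjective] at h2
    exact h2

namespace IsOneEigenbasis

variable {n p : ℕ} {K : Matrix (Fin n) (Fin n) ℝ} {V : Matrix (Fin n) (Fin p) ℝ}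

theorem mul_eq (hV : IsOneEigenbasis K V) : K * V = V := by
  ext i j
  have h : V.col j ∈ Module.End.eigenspace (Matrix.toLin' K) 1 :=
    hV.span_eq ▸ Submodule.subset_span ⟨j, rfl⟩
  rw [Module.End.mem_eigenspace_iff, one_smul, Matrix.toLin'_apply] at h
  exact congrFun h i

theorem projection_mulVec (hV : IsOneEigenbasis K V) {x : Fin n → ℝ} (hx : K.mulVec x = x) :
    V.mulVec (V.transpose.mulVec x) = x := by
  have h : x ∈ Submodule.span ℝ (Set.range V.col) := by
    rw [hV.span_eq, Module.End.mem_eigenspace_iff, one_smul, Matrix.toLin'_apply, hx]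
  rw [← Matrix.range_mulVecLin] at h
  obtain ⟨y, rfl⟩ := h
  rw [Matrix.mulVecLin_apply, Matrix.mulVec_mulVec y, hV.orthonormal, Matrix.one_mulVec]

theorem projection_mul {m : ℕ} (hV : IsOneEigenbasis K V) {E : Matrix (Fin n) (Fin m) ℝ}
    (hE : K * E = E) : V * V.transpose * E = E := by
  ext i j
  have h : K.mulVec (E.col j) = E.col j := by
    funext k
    exact congrFun (congrFun hE k) j
  have h2 := congrFun (hV.projection_mulVec h) i
  rw [Matrix.mulVec_mulVec] at h2
  exact h2

end IsOneEigenbasis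

theorem IsPseudoInverse.isSymm {n : ℕ} {A B : Matrix (Fin n) (Fin n) ℝ}
    (h : IsPseudoInverse A B) (hA : A.IsSymm) : B.IsSymm := by
  obtain ⟨C, hC, hCs⟩ :=
    exists_isPseudoInverse_of_isHermitian (A := A) (by rwa [Matrix.IsHermitian,
      Matrix.conjTranspose_eq_transpose_of_trivial])
  rwa [h.unique hC]

theorem IsPseudoInverse.commute {n : ℕ} {A B : Matrix (Fin n) (Fin n) ℝ}
    (h : IsPseudoInverse A B) (hA : A.IsSymm) : A * B = B * A := by
  rw [← h.isSymm_left.eq, Matrix.transpose_mul, hA.eq, (h.isSymm hA).eq]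

/-! ### From a marginal kernel to a nonnegative pair -/

namespace IsMarginalKernel

variable {n p : ℕ} {K : Matrix (Fin n) (Fin n) ℝ}

theorem isSymm (hK : IsMarginalKernel K) : K.IsSymm := by
  have h := hK.posSemidef.isHermitian
  rwa [Matrix.IsHermitian, Matrix.conjTranspose_eq_transpose_of_trivial] at h

theorem one_sub_isSymm (hK : IsMarginalKernel K) : (1 - K).IsSymm := by
  rw [Matrix.IsSymm, Matrix.transpose_sub, Matrix.transpose_one, hK.isSymm.eq]

/-- K(I - K) = K(I - K)K + (I - K)K(I - K) is a sum of congruences of positive semidefinite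
matrices, and conjugating it by (I - K)† gives K(I - K)†. -/
theorem posSemidef_mul_pseudoInverse (hK : IsMarginalKernel K) :
    (K * pseudoInverse (1 - K)).PosSemidef := by
  have hB := isPseudoInverse_pseudoInverse (1 - K)
  set B := pseudoInverse (1 - K)
  have hBs := hB.isSymm hK.one_sub_isSymm
  have hAB := hB.commute hK.one_sub_isSymm
  have hKB : K * B = B * K := by
    have : B - K * B = B - B * K := by simpa [sub_mul, mul_sub] using hAB
    exact sub_right_injective this
  have h1 : (K * (1 - K) * K + (1 - K) * K * (1 - K)).PosSemidef := by
    have ha := hK.posSemidef_one_sub.mul_mul_conjTranspose_same K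
    have hb := hK.posSemidef.mul_mul_conjTranspose_same (1 - K)
    rw [Matrix.conjTranspose_eq_transpose_of_trivial, hK.isSymm.eq] at ha
    rw [Matrix.conjTranspose_eq_transpose_of_trivial, hK.one_sub_isSymm.eq] at hb
    exact ha.add hb
  have h2 := h1.mul_mul_conjTranspose_same B
  rw [Matrix.conjTranspose_eq_transpose_of_trivial, hBs.eq] at h2
  have e : K * (1 - K) * K + (1 - K) * K * (1 - K) = K * (1 - K) := by noncomm_ring
  rw [e] at h2
  have e2 : B * (K * (1 - K)) * B = K * B := by
    calc B * (K * (1 - K)) * B = B * K * (1 - K) * B := by simp only [Matrix.mul_assoc]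
      _ = K * (B * (1 - K) * B) := by rw [← hKB]; simp only [Matrix.mul_assoc]
      _ = K * B := by rw [hB.mul_mul_right]
  rwa [e2] at h2

variable {V : Matrix (Fin n) (Fin p) ℝ}

theorem transpose_mul_one_sub (hK : IsMarginalKernel K) (hV : IsOneEigenbasis K V) :
    V.transpose * (1 - K) = 0 := by
  have h := congrArg Matrix.transpose hV.mul_eq
  rw [Matrix.transpose_mul, hK.isSymm.eq] at h
  rw [Matrix.mul_sub, Matrix.mul_one, h, sub_self]

/-- Both sides are the orthogonal projection onto the complement of ker(I - K). -/
theorem pseudoInverse_mul_one_sub (hK : IsMarginalKernel K) (hV : IsOneEigenbasis K V) :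
    pseudoInverse (1 - K) * (1 - K) = 1 - V * V.transpose := by
  have hB := isPseudoInverse_pseudoInverse (1 - K)
  set B := pseudoInverse (1 - K)
  have hAB := hB.commute hK.one_sub_isSymm
  have hE : K * (1 - B * (1 - K)) = 1 - B * (1 - K) := by
    have h : (1 - K) * (1 - B * (1 - K)) = 0 := by
      rw [mul_sub, mul_one, ← Matrix.mul_assoc, hB.mul_mul_left, sub_self]
    rw [sub_mul, one_mul, sub_eq_zero] at h
    exact h.symm
  have h1 := hV.projection_mul hE
  have h2 : V.transpose * (1 - B * (1 - K)) = V.transpose := by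
    rw [← hAB, Matrix.mul_sub, Matrix.mul_one, ← Matrix.mul_assoc,
      hK.transpose_mul_one_sub hV, Matrix.zero_mul, sub_zero]
  rw [Matrix.mul_assoc, h2] at h1
  rw [h1]
  abel

theorem isNonnegativePair (hK : IsMarginalKernel K) (hV : IsOneEigenbasis K V) :
    IsNonnegativePair (K * pseudoInverse (1 - K)) V where
  isSymm := by
    have h := hK.posSemidef_mul_pseudoInverse.isHermitian
    rwa [Matrix.IsHermitian, Matrix.conjTranspose_eq_transpose_of_trivial] at h
  rank_eq := by
    rw [← Matrix.rank_transpose_mul_self, hV.orthonormal, Matrix.rank_one, Fintype.card_fin]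
  nonneg x _ := by
    simpa using hK.posSemidef_mul_pseudoInverse.dotProduct_mulVec_nonneg x

/-- A null vector x would satisfy Kx = x and VVᵀx = 0, but VVᵀ fixes the eigenspace. -/
theorem posDef_one_sub_add (hK : IsMarginalKernel K) (hV : IsOneEigenbasis K V) :
    (1 - K + V * V.transpose).PosDef := by
  have hQ : (V * V.transpose).PosSemidef := by
    simpa [Matrix.conjTranspose_eq_transpose_of_trivial] using
      Matrix.posSemidef_self_mul_conjTranspose V
  have hN := hK.posSemidef_one_sub.add hQ
  refine Matrix.PosDef.of_dotProduct_mulVec_pos hN.isHermitian fun x hx => ?_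
  refine lt_of_le_of_ne (hN.dotProduct_mulVec_nonneg x) fun h0 => hx ?_
  have ha := hK.posSemidef_one_sub.dotProduct_mulVec_nonneg x
  have hb := hQ.dotProduct_mulVec_nonneg x
  rw [Matrix.add_mulVec, dotProduct_add] at h0
  have h1 : (1 - K).mulVec x = 0 :=
    (hK.posSemidef_one_sub.dotProduct_mulVec_zero_iff x).1 (by linarith)
  have h2 : (V * V.transpose).mulVec x = 0 :=
    (hQ.dotProduct_mulVec_zero_iff x).1 (by linarith)
  rw [Matrix.sub_mulVec, Matrix.one_mulVec, sub_eq_zero] at h1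
  rw [← hV.projection_mulVec h1.symm, Matrix.mulVec_mulVec, h2]

/-- A column operation replaces the corner by N = I - K + VVᵀ. Since NV = V, the Schur complement is
-VᵀN⁻¹V = -I. -/
theorem det_saddle_one_sub (hK : IsMarginalKernel K) (hV : IsOneEigenbasis K V) :
    (Matrix.fromBlocks (1 - K) V V.transpose 0).det =
      (-1) ^ p * (1 - K + V * V.transpose).det := by
  have hN := hK.posDef_one_sub_add hV
  set N := 1 - K + V * V.transpose with hNdef
  have : Invertible N := Matrix.invertibleOfIsUnitDet N hN.det_pos.ne'.isUnit
  have hNV : N * V = V := by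
    rw [hNdef, Matrix.add_mul, Matrix.sub_mul, hV.mul_eq, Matrix.one_mul, sub_self, zero_add,
      Matrix.mul_assoc,
      hV.orthonormal, Matrix.mul_one]
  have hNV' : ⅟N * V = V := by
    calc ⅟N * V = ⅟N * (N * V) := by rw [hNV]
      _ = V := by rw [← Matrix.mul_assoc, invOf_mul_self, Matrix.one_mul]
  have hmul : Matrix.fromBlocks (1 - K) V V.transpose 0 *
      Matrix.fromBlocks 1 0 V.transpose (1 : Matrix (Fin p) (Fin p) ℝ) =
      Matrix.fromBlocks N V V.transpose 0 := by
    rw [Matrix.fromBlocks_multiply]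
    simp [hNdef]
  have hdet := congrArg Matrix.det hmul
  rw [Matrix.det_mul, Matrix.det_fromBlocks_zero₁₂, Matrix.det_one, Matrix.det_one, mul_one,
    mul_one, Matrix.det_fromBlocks₁₁ N, Matrix.mul_assoc, hNV', hV.orthonormal, zero_sub,
    Matrix.det_neg, Matrix.det_one, Fintype.card_fin, mul_one, mul_comm] at hdet
  exact hdet

theorem det_one_sub_add_diagonal_mul (hK : IsMarginalKernel K) (hV : IsOneEigenbasis K V)
    (t : Fin n → ℝ) :
    (1 - K + Matrix.diagonal t * K).det = (1 - K + V * V.transpose).det * ((-1) ^ p *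
      (Matrix.fromBlocks (1 + Matrix.diagonal t * (K * pseudoInverse (1 - K)))
        (Matrix.diagonal t * V) V.transpose 0).det) := by
  have h11 : (1 + Matrix.diagonal t * (K * pseudoInverse (1 - K))) * (1 - K) +
      Matrix.diagonal t * V * V.transpose = 1 - K + Matrix.diagonal t * K := by
    have hKQ : K * (V * V.transpose) = V * V.transpose := by rw [← Matrix.mul_assoc, hV.mul_eq]
    rw [add_mul, one_mul, Matrix.mul_assoc, Matrix.mul_assoc K, hK.pseudoInverse_mul_one_sub hV,
      mul_sub K, hKQ, mul_one, Matrix.mul_assoc _ V, add_assoc, ← mul_add, sub_add_cancel]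
  have hmul : Matrix.fromBlocks (1 + Matrix.diagonal t * (K * pseudoInverse (1 - K)))
      (Matrix.diagonal t * V) V.transpose 0 * Matrix.fromBlocks (1 - K) V V.transpose 0 =
      Matrix.fromBlocks (1 - K + Matrix.diagonal t * K)
        ((1 + Matrix.diagonal t * (K * pseudoInverse (1 - K))) * V) 0 1 := by
    rw [Matrix.fromBlocks_multiply, h11, hK.transpose_mul_one_sub hV, hV.orthonormal]
    simp
  have hdet := congrArg Matrix.det hmul
  rw [Matrix.det_mul, Matrix.det_fromBlocks_zero₂₁, Matrix.det_one, mul_one,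
    hK.det_saddle_one_sub hV] at hdet
  rw [← hdet]
  ring

end IsMarginalKernel

theorem IsDPP.isExtendedLEnsemble {n p : ℕ} {Ω : Type*} [MeasurableSpace Ω] {P : Measure Ω}
    [IsProbabilityMeasure P] {𝒳 : Ω → Finset (Fin n)} (h𝒳 : Measurable 𝒳)
    {K : Matrix (Fin n) (Fin n) ℝ} (h : IsDPP P 𝒳 K) {V : Matrix (Fin n) (Fin p) ℝ}
    (hV : IsOneEigenbasis K V) : IsExtendedLEnsemble P 𝒳 (K * pseudoInverse (1 - K)) V := by
  have hK := h.isMarginalKernel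
  refine ⟨hK.isNonnegativePair hV, _, (hK.posDef_one_sub_add hV).det_pos,
    (proportional_iff_generating _ _ _).2 fun t => ?_⟩
  rw [(inclusion_iff_generating h𝒳 K).1 h.inclusion, hK.det_one_sub_add_diagonal_mul hV]

/-! ### From a nonnegative pair to a marginal kernel -/

/-- For a nonnegative pair with invertible saddle-point matrix at `1 + L`, the top-left block of
the inverse is `1 - K` for a marginal kernel `K`. -/
theorem IsNonnegativePair.exists_marginalKernel {n p : ℕ} {L : Matrix (Fin n) (Fin n) ℝ}
    {V : Matrix (Fin n) (Fin p) ℝ} (h : IsNonnegativePair L V)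
    (hdet : (Matrix.fromBlocks (1 + L) V V.transpose 0).det ≠ 0) :
    ∃ K, IsMarginalKernel K ∧ ∀ t : Fin n → ℝ,
      (Matrix.fromBlocks (1 + Matrix.diagonal t * L) (Matrix.diagonal t * V) V.transpose 0).det =
      (1 - K + Matrix.diagonal t * K).det * (Matrix.fromBlocks (1 + L) V V.transpose 0).det := by
  set M := Matrix.fromBlocks (1 + L) V V.transpose 0 with hM
  have hMs : M.IsSymm := by
    rw [Matrix.IsSymm, hM, Matrix.fromBlocks_transpose]
    simp [h.isSymm.eq]
  set W := M⁻¹ with hW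
  have hWs : W.IsSymm := by rw [Matrix.IsSymm, hW, Matrix.transpose_nonsing_inv, hMs.eq]
  have hMW : M * W = 1 := Matrix.mul_nonsing_inv M hdet.isUnit
  set C := W.toBlocks₁₁
  set D := W.toBlocks₁₂
  set E := W.toBlocks₂₁
  set F := W.toBlocks₂₂
  have hWb : W = Matrix.fromBlocks C D E F := (Matrix.fromBlocks_toBlocks W).symm
  have hCs : C.transpose = C := by
    have h := hWs
    rw [hWb, Matrix.IsSymm, Matrix.fromBlocks_transpose] at h
    exact (Matrix.fromBlocks_inj.1 h).1
  have hb := hMW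
  rw [hM, hWb, Matrix.fromBlocks_multiply, ← Matrix.fromBlocks_one, Matrix.fromBlocks_inj] at hb
  simp only [Matrix.zero_mul, add_zero] at hb
  obtain ⟨h11, h12, h21, h22⟩ := hb
  have hCV : C * V = 0 := by
    have h := congrArg Matrix.transpose h21
    rwa [Matrix.transpose_mul, Matrix.transpose_transpose, hCs, Matrix.transpose_zero] at h
  have hC : C * (1 + L) * C = C := by
    have h := congrArg (C * ·) h11
    simp only [Matrix.mul_add C, ← Matrix.mul_assoc, hCV, Matrix.zero_mul, add_zero,
      Matrix.mul_one] at h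
    simpa only [Matrix.mul_add, Matrix.mul_one] using h
  have hCh : C.IsHermitian := by
    rw [Matrix.IsHermitian, Matrix.conjTranspose_eq_transpose_of_trivial, hCs]
  have hCLC : (C * L * C).PosSemidef := by
    refine Matrix.PosSemidef.of_dotProduct_mulVec_nonneg ?_ fun x => ?_
    · rw [Matrix.IsHermitian, Matrix.conjTranspose_eq_transpose_of_trivial, Matrix.transpose_mul,
        Matrix.transpose_mul, hCs, h.isSymm.eq, Matrix.mul_assoc]
    -- The range of `C` lies in the kernel of Vᵀ, exactly where the form of `L` is known to be
    -- nonnegative.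
    · have h1 := h.nonneg (C.mulVec x) (by rw [Matrix.mulVec_mulVec, h21, Matrix.zero_mulVec])
      have h2 : star x ⬝ᵥ (C * L * C).mulVec x = C.mulVec x ⬝ᵥ L.mulVec (C.mulVec x) := by
        rw [star_trivial, ← Matrix.mulVec_mulVec, ← Matrix.mulVec_mulVec, Matrix.dotProduct_mulVec,
          ← Matrix.mulVec_transpose, hCs]
      rwa [h2]
  have hsq : ∀ A : Matrix (Fin n) (Fin n) ℝ, A.transpose = A → (A * A).PosSemidef := by
    intro A hA
    have h := Matrix.posSemidef_conjTranspose_mul_self A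
    rwa [Matrix.conjTranspose_eq_transpose_of_trivial, hA] at h
  have hexp : C * C + C * L * C = C := by
    rwa [Matrix.mul_add, Matrix.mul_one, Matrix.add_mul] at hC
  refine ⟨1 - C, ⟨?_, ?_⟩, fun t => ?_⟩
  · have e : 1 - C = (1 - C) * (1 - C) + C * L * C := by
      rw [← sub_eq_iff_eq_add'.2 hexp.symm]
      noncomm_ring
    rw [e]
    exact (hsq _ (by rw [Matrix.transpose_sub, Matrix.transpose_one, hCs])).add hCLC
  · rw [sub_sub_cancel, ← hexp]
    exact (hsq _ hCs).add hCLC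
  · have h11' : L * C + V * E = 1 - C := by
      rw [← h11, Matrix.add_mul, Matrix.one_mul]
      abel
    have hmul : Matrix.fromBlocks (1 + Matrix.diagonal t * L) (Matrix.diagonal t * V)
        V.transpose 0 * W = Matrix.fromBlocks (1 - (1 - C) + Matrix.diagonal t * (1 - C))
          ((1 + Matrix.diagonal t * L) * D + Matrix.diagonal t * V * F) 0 1 := by
      rw [hWb, Matrix.fromBlocks_multiply, h21, h22, ← h11', Matrix.mul_add, h11', Matrix.add_mul]
      simp [Matrix.mul_assoc, add_assoc]
    have hd := congrArg Matrix.det hmul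
    rw [Matrix.det_mul, Matrix.det_fromBlocks_zero₂₁, Matrix.det_one, mul_one] at hd
    have hMW' : W.det * M.det = 1 := by
      rw [mul_comm, ← Matrix.det_mul, hMW, Matrix.det_one]
    rw [← hd, mul_assoc, hMW', mul_one]

theorem IsExtendedLEnsemble.exists_isDPP {n p : ℕ} {Ω : Type*} [MeasurableSpace Ω] {P : Measure Ω}
    [IsProbabilityMeasure P] {𝒳 : Ω → Finset (Fin n)} (h𝒳 : Measurable 𝒳)
    {L : Matrix (Fin n) (Fin n) ℝ} {V : Matrix (Fin n) (Fin p) ℝ}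
    (h : IsExtendedLEnsemble P 𝒳 L V) : ∃ K, IsDPP P 𝒳 K := by
  obtain ⟨hLV, c, -, hc⟩ := h
  have hgen := (proportional_iff_generating L V c).1 hc
  -- Total mass one, read at t = 1, fixes `c` and makes the determinant nonzero.
  have h1 : c * ((-1) ^ p * (Matrix.fromBlocks (1 + L) V V.transpose 0).det) = 1 := by
    have h := hgen fun _ => 1
    simp only [Finset.prod_const_one, one_mul, sum_measureReal_eq_one h𝒳, Matrix.diagonal_one,
      Matrix.one_mul] at h
    exact h.symm
  obtain ⟨K, hK, hdet⟩ := hLV.exists_marginalKernel fun h0 => by simp [h0] at h1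
  refine ⟨K, hK, (inclusion_iff_generating h𝒳 K).2 fun t => ?_⟩
  rw [hgen, hdet]
  linear_combination (1 - K + Matrix.diagonal t * K).det * h1

theorem mainTheorem3 {n : ℕ} {Ω : Type*} [MeasurableSpace Ω] (P : Measure Ω)
    [IsProbabilityMeasure P] (𝒳 : Ω → Finset (Fin n)) (h𝒳 : Measurable 𝒳) :
    (∀ K : Matrix (Fin n) (Fin n) ℝ, IsDPP P 𝒳 K →
      (∃ (p : ℕ) (V : Matrix (Fin n) (Fin p) ℝ), IsOneEigenbasis K V) ∧
      ∀ (p : ℕ) (V : Matrix (Fin n) (Fin p) ℝ), IsOneEigenbasis K V →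
        IsExtendedLEnsemble P 𝒳 (K * pseudoInverse (1 - K)) V) ∧
    ((∃ K : Matrix (Fin n) (Fin n) ℝ, IsDPP P 𝒳 K) ↔
      ∃ (p : ℕ) (L : Matrix (Fin n) (Fin n) ℝ) (V : Matrix (Fin n) (Fin p) ℝ),
        IsExtendedLEnsemble P 𝒳 L V) := by
  have h1 : ∀ K : Matrix (Fin n) (Fin n) ℝ, IsDPP P 𝒳 K →
      ∀ (p : ℕ) (V : Matrix (Fin n) (Fin p) ℝ), IsOneEigenbasis K V →
        IsExtendedLEnsemble P 𝒳 (K * pseudoInverse (1 - K)) V :=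
    fun K hK p V hV => hK.isExtendedLEnsemble h𝒳 hV
  refine ⟨fun K hK => ⟨exists_isOneEigenbasis K, h1 K hK⟩, ?_, ?_⟩
  · rintro ⟨K, hK⟩
    obtain ⟨p, V, hV⟩ := exists_isOneEigenbasis K
    exact ⟨p, _, V, h1 K hK p V hV⟩
  · rintro ⟨p, L, V, h⟩
    exact h.exists_isDPP h𝒳
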